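/- Let $\mathcal H,\mathcal K$ be finite-dimensional complex Hilbert spaces and let $\mathcal A\subseteq B(\mathcal H)$, $\mathcal B\subseteq B(\mathcal K)$ be $C^*$-algebras containing the identity operators. Density operators in $\mathcal A$ are the elements $\sigma\ge 0$ of $\mathcal A$ with $\mathrm{Tr}\,\sigma=1$. For a linear map $T:\mathcal A\to\mathcal B$ let $T^*:\mathcal B\to\mathcal A$ be its adjoint for the Hilbert--Schmidt inner products $\langle a,b\rangle=\mathrm{Tr}\,a^*b$. A linear map $\Phi$ between such algebras is a unital Schwarz map if $\Phi(I)=I$ and $\Phi(a^*a)\ge\Phi(a)^*\Phi(a)$ for all $a$. If $T^*$ is a unital Schwarz map and $\mathcal S$ is a set of density operators in $\mathcal A$, then $T$ is called reversible for $\mathcal S$ if there is a linear map $S:\mathcal B\to\mathcal A$ such that $S^*$ is a unital Schwarz map and $S(T(\sigma))=\sigma$ for all $\sigma\in\mathcal S$. Let $\mathcal S$ be a set of density operators in $\mathcal A$ and $T:\mathcal A\to\mathcal B$ a linear map such that 1. $\mathcal S$ contains an element $\rho$ such that $\rho$ and $T(\rho)$ are invertible; 2. both $T^*$ and the map $T_\rho:\mathcal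 A\to\mathcal B$, $T_\rho(b)=T(\rho)^{-1/2}\,T(\rho^{1/2}b\rho^{1/2})\,T(\rho)^{-1/2}$, are unital Schwarz maps. Then $T$ is reversible for $\mathcal S$ if and only if $T$ is reversible for $$\tilde{\mathcal S}:=\bigcup_{s\in\mathbb R}\rho^{is}\mathcal S\rho^{-is}=\{\rho^{is}\sigma\rho^{-is}:\ \sigma\in\mathcal S,\ s\in\mathbb R\}.$$ -/

import Mathlib

noncomputable section

namespace QuantumReversibility

section Adjoint

/-- The adjoint of a linear map between finite dimensional complex vector spaces
with respect to explicitly given inner products. -/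
def coreAdjoint {V W : Type*} [AddCommGroup V] [Module ℂ V] [FiniteDimensional ℂ V]
    [AddCommGroup W] [Module ℂ W] [FiniteDimensional ℂ W]
    (cV : InnerProductSpace.Core ℂ V) (cW : InnerProductSpace.Core ℂ W)
    (T : V →ₗ[ℂ] W) : W →ₗ[ℂ] V :=
  letI : NormedAddCommGroup V := cV.toNormedAddCommGroup
  letI : InnerProductSpace ℂ V := InnerProductSpace.ofCore cV.toCore
  letI : NormedAddCommGroup W := cW.toNormedAddCommGroup
  letI : InnerProductSpace ℂ W := InnerProductSpace.ofCore cW.toCore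
  LinearMap.adjoint T

theorem coreAdjoint_inner {V W : Type*} [AddCommGroup V] [Module ℂ V] [FiniteDimensional ℂ V]
    [AddCommGroup W] [Module ℂ W] [FiniteDimensional ℂ W]
    (cV : InnerProductSpace.Core ℂ V) (cW : InnerProductSpace.Core ℂ W)
    (T : V →ₗ[ℂ] W) (w : W) (v : V) :
    cV.inner (coreAdjoint cV cW T w) v = cW.inner w (T v) := by
  let : NormedAddCommGroup V := cV.toNormedAddCommGroup
  let : InnerProductSpace ℂ V := InnerProductSpace.ofCore cV.toCore
  let : NormedAddCommGroup W := cW.toNormedAddCommGroup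
  let : InnerProductSpace ℂ W := InnerProductSpace.ofCore cW.toCore
  exact LinearMap.adjoint_inner_left T v w

end Adjoint

variable {H : Type*} [NormedAddCommGroup H] [InnerProductSpace ℂ H] [FiniteDimensional ℂ H]
  [CompleteSpace H]
variable {K : Type*} [NormedAddCommGroup K] [InnerProductSpace ℂ K] [FiniteDimensional ℂ K]
  [CompleteSpace K]

/-- The trace `Tr = Tr_H` on `B(H)`. -/
def tr (a : H →L[ℂ] H) : ℂ := LinearMap.trace ℂ H (a : H →ₗ[ℂ] H)

theorem tr_star (a : H →L[ℂ] H) : tr (star a) = star (tr a) := by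
  unfold tr
  rw [LinearMap.trace_eq_sum_inner _ (stdOrthonormalBasis ℂ H),
    LinearMap.trace_eq_sum_inner _ (stdOrthonormalBasis ℂ H), star_sum]
  refine Finset.sum_congr rfl fun i _ => ?_
  simp [ContinuousLinearMap.star_eq_adjoint, ContinuousLinearMap.adjoint_inner_right]

theorem tr_star_mul_self (a : H →L[ℂ] H) :
    tr (star a * a) = ∑ i, ((‖a (stdOrthonormalBasis ℂ H i)‖ ^ 2 : ℝ) : ℂ) := by
  unfold tr
  rw [LinearMap.trace_eq_sum_inner _ (stdOrthonormalBasis ℂ H)]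
  refine Finset.sum_congr rfl fun i _ => ?_
  simp [ContinuousLinearMap.star_eq_adjoint, ContinuousLinearMap.adjoint_inner_right,
    inner_self_eq_norm_sq_to_K]

theorem eq_zero_of_tr_star_mul_self (a : H →L[ℂ] H) (h : tr (star a * a) = 0) : a = 0 := by
  rw [tr_star_mul_self, ← Complex.ofReal_sum, Complex.ofReal_eq_zero,
    Finset.sum_eq_zero_iff_of_nonneg (fun i _ => by positivity)] at h
  have h' : (a : H →ₗ[ℂ] H) = 0 :=
    (stdOrthonormalBasis ℂ H).toBasis.ext fun i => by simpa using h i (Finset.mem_univ i)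
  ext x
  simpa using LinearMap.congr_fun h' x

/-- The Hilbert-Schmidt inner product `⟨a, b⟩ = Tr (a* b)` on a `*`-subalgebra of `B(H)`. -/
@[reducible] def hsCore (A : StarSubalgebra ℂ (H →L[ℂ] H)) : InnerProductSpace.Core ℂ A where
  inner a b := tr (star (a : H →L[ℂ] H) * (b : H →L[ℂ] H))
  conj_inner_symm a b := by
    rw [starRingEnd_apply, ← tr_star, star_mul, star_star]
  re_inner_nonneg a := by
    rw [tr_star_mul_self, ← Complex.ofReal_sum, RCLike.re_eq_complex_re, Complex.ofReal_re]
    exact Finset.sum_nonneg fun i _ => sq_nonneg _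
  add_left a b c := by simp [add_mul, tr]
  smul_left a b r := by simp [tr]
  definite a h := Subtype.ext (eq_zero_of_tr_star_mul_self _ h)

instance instFiniteDimensional (A : StarSubalgebra ℂ (H →L[ℂ] H)) : FiniteDimensional ℂ A :=
  inferInstanceAs (FiniteDimensional ℂ (Subalgebra.toSubmodule A.toSubalgebra))

theorem isClosed_coe (A : StarSubalgebra ℂ (H →L[ℂ] H)) : IsClosed (A : Set (H →L[ℂ] H)) :=
  Submodule.closed_of_finiteDimensional (Subalgebra.toSubmodule A.toSubalgebra)

/-- The adjoint `T*` of a linear map `T : A → B` with respect to the Hilbert-Schmidt inner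
products. -/
def hsAdjoint {A : StarSubalgebra ℂ (H →L[ℂ] H)} {B : StarSubalgebra ℂ (K →L[ℂ] K)}
    (T : A →ₗ[ℂ] B) : B →ₗ[ℂ] A :=
  coreAdjoint (hsCore A) (hsCore B) T

theorem hsAdjoint_spec {A : StarSubalgebra ℂ (H →L[ℂ] H)} {B : StarSubalgebra ℂ (K →L[ℂ] K)}
    (T : A →ₗ[ℂ] B) (b : B) (a : A) :
    tr (star (hsAdjoint T b : H →L[ℂ] H) * (a : H →L[ℂ] H)) =
      tr (star (b : K →L[ℂ] K) * (T a : K →L[ℂ] K)) :=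
  coreAdjoint_inner (hsCore A) (hsCore B) T b a

/-- Unital Schwarz maps: `Φ(1) = 1` and `Φ(a)* Φ(a) ≤ Φ(a* a)` for all `a`, in the Loewner
order of operators. -/
structure IsUnitalSchwarz {A : StarSubalgebra ℂ (H →L[ℂ] H)} {B : StarSubalgebra ℂ (K →L[ℂ] K)}
    (Φ : A →ₗ[ℂ] B) : Prop where
  map_one : Φ 1 = 1
  schwarz : ∀ a : A, ((star (Φ a) * Φ a : B) : K →L[ℂ] K) ≤ (Φ (star a * a) : K →L[ℂ] K)

/-- Density operators in `A`: positive elements with unit trace. -/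
def densities (A : StarSubalgebra ℂ (H →L[ℂ] H)) : Set A :=
  {a | 0 ≤ (a : H →L[ℂ] H) ∧ tr (a : H →L[ℂ] H) = 1}

/-- The real power `a ^ y` of `a ∈ A`, as an element of `A`. -/
def rpowIn {A : StarSubalgebra ℂ (H →L[ℂ] H)} (a : A) (y : ℝ) : A :=
  ⟨(a : H →L[ℂ] H) ^ y, by
    have := isClosed_coe A
    change cfc _ _ ∈ A
    by_cases ha : 0 ≤ (a : H →L[ℂ] H)
    · rw [cfc_nnreal_eq_real _ _ ha]
      exact cfc_mem (𝕜 := ℝ) (𝕜' := ℂ) _ a.2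
    · rw [cfc_apply_of_not_predicate _ ha]
      exact A.zero_mem⟩

/-- The imaginary power `a ^ (i s)`, as an element of `A`, for positive invertible `a ∈ A`
(where `x ^ (i s) = exp (i s log x)` on the spectrum of `a`). -/
def ipowIn {A : StarSubalgebra ℂ (H →L[ℂ] H)} (a : A) (s : ℝ) : A :=
  ⟨cfc (fun x : ℂ => x ^ (Complex.I * (s : ℂ))) (a : H →L[ℂ] H),
    have := isClosed_coe A
    cfc_mem (𝕜 := ℂ) (𝕜' := ℂ) _ a.2⟩

/-- The dual map `T_ρ(b) = T(ρ)^{-1/2} T(ρ^{1/2} b ρ^{1/2}) T(ρ)^{-1/2}`. -/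
def dualMap {A : StarSubalgebra ℂ (H →L[ℂ] H)} {B : StarSubalgebra ℂ (K →L[ℂ] K)}
    (T : A →ₗ[ℂ] B) (ρ : A) : A →ₗ[ℂ] B where
  toFun b := rpowIn (T ρ) (-(1 / 2)) * T (rpowIn ρ (1 / 2) * b * rpowIn ρ (1 / 2)) *
    rpowIn (T ρ) (-(1 / 2))
  map_add' b c := by simp only [mul_add, add_mul, map_add]
  map_smul' r b := by
    simp only [mul_smul_comm, smul_mul_assoc, map_smul, RingHom.id_apply]

/-- `T` is reversible for `S`: some linear `R : B → A` whose adjoint is a unital Schwarz map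
satisfies `R (T σ) = σ` for all `σ ∈ S`. -/
def IsReversible {A : StarSubalgebra ℂ (H →L[ℂ] H)} {B : StarSubalgebra ℂ (K →L[ℂ] K)}
    (T : A →ₗ[ℂ] B) (S : Set A) : Prop :=
  ∃ R : B →ₗ[ℂ] A, IsUnitalSchwarz (hsAdjoint R) ∧ ∀ σ ∈ S, R (T σ) = σ

/-- The modular orbit `⋃ₛ ρ^{is} S ρ^{-is}`. -/
def modularOrbit {A : StarSubalgebra ℂ (H →L[ℂ] H)} (ρ : A) (S : Set A) : Set A :=
  ⋃ s : ℝ, (fun σ : A => ipowIn ρ s * σ * ipowIn ρ (-s)) '' S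

end QuantumReversibility

end

/-!
Let `M = R ∘ T`, where `R` recovers `𝒮`; then `M ρ = ρ` and `L = M* = T* ∘ R*` is a unital Schwarz
map. The Schwarz inequality and `M ρ = ρ` make `L` a contraction for the GNS inner product
`⟨a, b⟩ = Tr (a* b ρ)`, whose adjoint there is `b ↦ M (b ρ) ρ⁻¹`. A contraction and its adjoint have
the same fixed vectors, so `L a = a` if and only if `M (a ρ) = a ρ`. Since `L` and `M` preserve `*`,
`M (a ρ) = a ρ` also gives `M (ρ a) = ρ a`: the fixed points of `M` are stable under
`τ ↦ ρ τ ρ⁻¹`. On each corner between two eigenspaces of `ρ`, with eigenvalues `μ` and `ν`, this map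
is multiplication by `μ / ν`, and `τ ↦ ρ ^ (i s) τ ρ ^ (-i s)` is multiplication by
`(μ / ν) ^ (i s)`. By Lagrange interpolation the latter map is a polynomial in the former, so `M`
also fixes the modular orbits of its fixed points, and `R` itself recovers the orbit of `𝒮`.
-/

noncomputable section

namespace QuantumReversibility

section SpectralProjection

open Polynomial

variable {𝕜 𝒜 : Type*} [RCLike 𝕜] [Ring 𝒜] [StarRing 𝒜] [TopologicalSpace 𝒜] [Algebra 𝕜 𝒜]
  {p : 𝒜 → Prop} [ContinuousFunctionalCalculus 𝕜 𝒜 p] {a : 𝒜}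

/-- The spectral projection of `a` onto the isolated point `μ` of its spectrum, i.e. the projection
onto the eigenspace of `μ` when the spectrum is finite. -/
def spectralProj (a : 𝒜) (μ : 𝕜) : 𝒜 := cfc (Pi.single μ 1 : 𝕜 → 𝕜) a

theorem cfc_eq_sum_spectralProj (hfin : (spectrum 𝕜 a).Finite) (f : 𝕜 → 𝕜) :
    cfc f a = ∑ μ ∈ hfin.toFinset, f μ • spectralProj a μ := by
  have hcont (g : 𝕜 → 𝕜) : ContinuousOn g (spectrum 𝕜 a) := hfin.continuousOn g
  have hf : (spectrum 𝕜 a).EqOn f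
      (∑ μ ∈ hfin.toFinset, fun z ↦ f μ * (Pi.single μ 1 : 𝕜 → 𝕜) z) := by
    intro z hz
    simp [Pi.single_apply, hz]
  rw [cfc_congr hf, cfc_sum _ a _ fun _ _ ↦ hcont _]
  exact Finset.sum_congr rfl fun μ _ ↦ cfc_const_mul _ _ a (hcont _)

theorem sum_spectralProj (ha : p a) (hfin : (spectrum 𝕜 a).Finite) :
    ∑ μ ∈ hfin.toFinset, spectralProj a μ = 1 := by
  simpa using! (cfc_eq_sum_spectralProj hfin (1 : 𝕜 → 𝕜)).symm.trans (cfc_one 𝕜 a)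

theorem mul_spectralProj (ha : p a) (hfin : (spectrum 𝕜 a).Finite) (μ : 𝕜) :
    a * spectralProj a μ = μ • spectralProj a μ := by
  have hcont (g : 𝕜 → 𝕜) : ContinuousOn g (spectrum 𝕜 a) := hfin.continuousOn g
  calc a * spectralProj a μ = cfc (fun z : 𝕜 ↦ z) a * cfc (Pi.single μ 1 : 𝕜 → 𝕜) a := by
        rw [cfc_id' 𝕜 a, spectralProj]
    _ = cfc (fun z ↦ μ * (Pi.single μ 1 : 𝕜 → 𝕜) z) a := by
        rw [← cfc_mul _ _ a (hcont _) (hcont _)]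
        congr 1 with z
        rcases eq_or_ne z μ with rfl | hz <;> simp [*]
    _ = μ • spectralProj a μ := cfc_const_mul _ _ a (hcont _)

theorem commute_spectralProj (ha : p a) (μ : 𝕜) : Commute a (spectralProj a μ) := by
  have h := cfc_commute_cfc (id : 𝕜 → 𝕜) (Pi.single μ 1) a
  rwa [cfc_id 𝕜 a] at h

theorem spectralProj_mul_inv {u : 𝒜ˣ} (hu : p u) (hfin : (spectrum 𝕜 (u : 𝒜)).Finite) {μ : 𝕜}
    (hμ : μ ∈ spectrum 𝕜 (u : 𝒜)) :
    spectralProj (u : 𝒜) μ * ↑u⁻¹ = μ⁻¹ • spectralProj (u : 𝒜) μ := by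
  have hμ0 : μ ≠ 0 := spectrum.ne_zero_of_mem_of_unit hμ
  rw [Units.mul_inv_eq_iff_eq_mul, smul_mul_assoc, ← (commute_spectralProj hu μ).eq,
    mul_spectralProj hu hfin, inv_smul_smul₀ hμ0]

theorem exists_polynomial_eqOn {s : Set 𝕜} (hs : s.Finite) (h : 𝕜 → 𝕜) :
    ∃ P : 𝕜[X], ∀ z ∈ s, P.eval z = h z :=
  ⟨Lagrange.interpolate hs.toFinset id h, fun _ hz ↦
    Lagrange.eval_interpolate_at_node h (Set.injOn_id _) (hs.mem_toFinset.mpr hz)⟩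

theorem mulLeftRight_spectralProj_mul_mul {u : 𝒜ˣ} (hu : p u)
    (hfin : (spectrum 𝕜 (u : 𝒜)).Finite) (x : 𝒜) (μ : 𝕜) {ν : 𝕜}
    (hν : ν ∈ spectrum 𝕜 (u : 𝒜)) :
    LinearMap.mulLeftRight 𝕜 ((u : 𝒜), (↑u⁻¹ : 𝒜))
        (spectralProj (u : 𝒜) μ * x * spectralProj (u : 𝒜) ν) =
      (μ * ν⁻¹) • (spectralProj (u : 𝒜) μ * x * spectralProj (u : 𝒜) ν) := by
  rw [LinearMap.mulLeftRight_apply, ← mul_assoc, ← mul_assoc, mul_spectralProj hu hfin,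
    mul_assoc _ _ (↑u⁻¹ : 𝒜), spectralProj_mul_inv hu hfin hν]
  simp only [smul_mul_assoc, mul_smul_comm, smul_smul, mul_comm ν⁻¹]

theorem sum_spectralProj_mul_mul_spectralProj (ha : p a) (hfin : (spectrum 𝕜 a).Finite) (x : 𝒜) :
    ∑ μ ∈ hfin.toFinset, ∑ ν ∈ hfin.toFinset, spectralProj a μ * x * spectralProj a ν = x := by
  simp_rw [← Finset.mul_sum, ← Finset.sum_mul, sum_spectralProj ha, one_mul, mul_one]

theorem exists_cfc_mul_mul_cfc_eq_aeval {u : 𝒜ˣ} (hu : p u)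
    (hfin : (spectrum 𝕜 (u : 𝒜)).Finite) {f g h : 𝕜 → 𝕜}
    (hfgh : ∀ μ ∈ spectrum 𝕜 (u : 𝒜), ∀ ν ∈ spectrum 𝕜 (u : 𝒜), f μ * g ν = h (μ * ν⁻¹)) :
    ∃ P : 𝕜[X], ∀ x : 𝒜, cfc f (u : 𝒜) * x * cfc g (u : 𝒜) =
      aeval (LinearMap.mulLeftRight 𝕜 ((u : 𝒜), (↑u⁻¹ : 𝒜))) P x := by
  obtain ⟨P, hP⟩ := exists_polynomial_eqOn (hfin.image2 (fun μ ν ↦ μ * ν⁻¹) hfin) h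
  refine ⟨P, fun x ↦ ?_⟩
  conv_rhs => rw [← sum_spectralProj_mul_mul_spectralProj hu hfin x]
  simp_rw [cfc_eq_sum_spectralProj hfin, Finset.sum_mul, Finset.mul_sum, map_sum]
  refine Finset.sum_congr rfl fun μ hμ ↦ Finset.sum_congr rfl fun ν hν ↦ ?_
  rw [hfin.mem_toFinset] at hμ hν
  rw [Module.End.aeval_apply_of_mem_apply_eq_smul
      (mulLeftRight_spectralProj_mul_mul hu hfin x μ hν),
    hP _ (Set.mem_image2_of_mem hμ hν), ← hfgh μ hμ ν hν]
  simp only [smul_mul_assoc, mul_smul_comm, smul_smul, mul_comm (g ν)]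

theorem aeval_apply_mem {R M : Type*} [CommRing R] [AddCommGroup M] [Module R M]
    {D : Module.End R M} {N : Submodule R M} (hN : ∀ x ∈ N, D x ∈ N) (P : R[X]) {x : M}
    (hx : x ∈ N) : aeval D P x ∈ N := by
  rw [aeval_eq_sum_range, LinearMap.sum_apply]
  refine N.sum_mem fun n _ ↦ N.smul_mem _ ?_
  rw [Module.End.pow_apply]
  exact (show Set.MapsTo D N N from hN).iterate n hx

theorem cfc_mul_mul_cfc_mem {u : 𝒜ˣ} (hu : p u) (hfin : (spectrum 𝕜 (u : 𝒜)).Finite)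
    {f g h : 𝕜 → 𝕜}
    (hfgh : ∀ μ ∈ spectrum 𝕜 (u : 𝒜), ∀ ν ∈ spectrum 𝕜 (u : 𝒜), f μ * g ν = h (μ * ν⁻¹))
    {N : Submodule 𝕜 𝒜} (hN : ∀ x ∈ N, ↑u * x * ↑u⁻¹ ∈ N) {x : 𝒜} (hx : x ∈ N) :
    cfc f (u : 𝒜) * x * cfc g (u : 𝒜) ∈ N := by
  obtain ⟨P, hP⟩ := exists_cfc_mul_mul_cfc_eq_aeval hu hfin hfgh
  rw [hP]
  exact aeval_apply_mem hN P hx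

end SpectralProjection

theorem finite_spectrum {𝕜 E : Type*} [NontriviallyNormedField 𝕜] [CompleteSpace 𝕜]
    [NormedAddCommGroup E] [NormedSpace 𝕜 E] [FiniteDimensional 𝕜 E] (a : E →L[𝕜] E) :
    (spectrum 𝕜 a).Finite := by
  rw [← AlgEquiv.spectrum_eq (Module.End.toContinuousLinearMap E).symm a]
  exact Module.End.finite_spectrum _

theorem apply_eq_self_iff_of_norm_apply_le {𝕜 E : Type*} [RCLike 𝕜] [NormedAddCommGroup E]
    [InnerProductSpace 𝕜 E] {V W : E → E} (hV : ∀ x, ‖V x‖ ≤ ‖x‖)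
    (hVW : ∀ x y, inner 𝕜 (V x) y = inner 𝕜 x (W y)) (x : E) : V x = x ↔ W x = x := by
  have hW (y : E) : ‖W y‖ ≤ ‖y‖ := by
    rcases (norm_nonneg (W y)).eq_or_lt' with h0 | hpos
    · exact h0 ▸ norm_nonneg y
    refine le_of_mul_le_mul_left ?_ hpos
    calc ‖W y‖ * ‖W y‖ = RCLike.re (inner 𝕜 (V (W y)) y) := by
          rw [hVW, ← inner_self_eq_norm_mul_norm (𝕜 := 𝕜)]
      _ ≤ ‖V (W y)‖ * ‖y‖ := re_inner_le_norm (𝕜 := 𝕜) _ _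
      _ ≤ ‖W y‖ * ‖y‖ := by gcongr; exact hV _
  constructor <;> intro hx
  · refine eq_of_norm_le_re_inner_eq_norm_sq (𝕜 := 𝕜) (hW x) ?_
    rw [inner_re_symm, ← hVW, hx, inner_self_eq_norm_sq]
  · refine eq_of_norm_le_re_inner_eq_norm_sq (𝕜 := 𝕜) (hV x) ?_
    rw [hVW, hx, inner_self_eq_norm_sq]

theorem core_apply_eq_self_iff_of_inner_apply_le {𝕜 E : Type*} [RCLike 𝕜] [AddCommGroup E]
    [Module 𝕜 E] (c : InnerProductSpace.Core 𝕜 E) {V W : E → E}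
    (hV : ∀ x, RCLike.re (c.inner (V x) (V x)) ≤ RCLike.re (c.inner x x))
    (hVW : ∀ x y, c.inner (V x) y = c.inner x (W y)) (x : E) : V x = x ↔ W x = x := by
  let : NormedAddCommGroup E := c.toNormedAddCommGroup
  let : InnerProductSpace 𝕜 E := InnerProductSpace.ofCore c.toCore
  exact apply_eq_self_iff_of_norm_apply_le (fun x ↦ Real.sqrt_le_sqrt (hV x)) hVW x

theorem coreAdjoint_comp {U V W : Type*} [AddCommGroup U] [Module ℂ U] [FiniteDimensional ℂ U]
    [AddCommGroup V] [Module ℂ V] [FiniteDimensional ℂ V]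
    [AddCommGroup W] [Module ℂ W] [FiniteDimensional ℂ W]
    (cU : InnerProductSpace.Core ℂ U) (cV : InnerProductSpace.Core ℂ V)
    (cW : InnerProductSpace.Core ℂ W) (R : V →ₗ[ℂ] W) (T : U →ₗ[ℂ] V) :
    coreAdjoint cU cW (R ∘ₗ T) = coreAdjoint cU cV T ∘ₗ coreAdjoint cV cW R := by
  let : NormedAddCommGroup U := cU.toNormedAddCommGroup
  let : InnerProductSpace ℂ U := InnerProductSpace.ofCore cU.toCore
  let : NormedAddCommGroup V := cV.toNormedAddCommGroup
  let : InnerProductSpace ℂ V := InnerProductSpace.ofCore cV.toCore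
  let : NormedAddCommGroup W := cW.toNormedAddCommGroup
  let : InnerProductSpace ℂ W := InnerProductSpace.ofCore cW.toCore
  exact LinearMap.adjoint_comp R T

open scoped ComplexOrder in
theorem cpow_mul_cpow_neg {z w : ℂ} (hz : 0 ≤ z) (hw : 0 ≤ w) (r : ℂ) :
    z ^ r * w ^ (-r) = (z * w⁻¹) ^ r := by
  lift z to ℝ using (Complex.nonneg_iff.mp hz).2.symm with x
  lift w to ℝ using (Complex.nonneg_iff.mp hw).2.symm with y
  rw [Complex.zero_le_real] at hz hw
  rw [← div_eq_mul_inv, Complex.div_cpow_ofReal_nonneg hz hw,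
    Complex.cpow_neg, div_eq_mul_inv]

section Operators

variable {H : Type*} [NormedAddCommGroup H] [InnerProductSpace ℂ H]

theorem tr_mul_comm (a b : H →L[ℂ] H) : tr (a * b) = tr (b * a) :=
  LinearMap.trace_mul_comm ℂ (a : H →ₗ[ℂ] H) (b : H →ₗ[ℂ] H)

variable [FiniteDimensional ℂ H] [CompleteSpace H]

theorem re_tr_mul_nonneg {a b : H →L[ℂ] H} (ha : 0 ≤ a) (hb : 0 ≤ b) :
    0 ≤ (tr (a * b)).re := by
  obtain ⟨s, rfl⟩ := CStarAlgebra.nonneg_iff_eq_star_mul_self.mp ha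
  obtain ⟨t, rfl⟩ := CStarAlgebra.nonneg_iff_eq_mul_star_self.mp hb
  have h : tr (star s * s * (t * star t)) = tr (star (s * t) * (s * t)) := by
    rw [← mul_assoc, tr_mul_comm, star_mul]
    simp only [mul_assoc]
  rw [h, tr_star_mul_self, ← Complex.ofReal_sum, Complex.ofReal_re]
  positivity

theorem re_tr_mul_le_re_tr_mul {a b c : H →L[ℂ] H} (hab : a ≤ b) (hc : 0 ≤ c) :
    (tr (a * c)).re ≤ (tr (b * c)).re := by
  have h := re_tr_mul_nonneg (sub_nonneg.mpr hab) hc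
  simpa [sub_mul, tr] using h

variable {A : StarSubalgebra ℂ (H →L[ℂ] H)}
variable {K : Type*} [NormedAddCommGroup K] [InnerProductSpace ℂ K] [CompleteSpace K]
  {B : StarSubalgebra ℂ (K →L[ℂ] K)}

theorem exists_star_mul_self_eq {a : A} (ha : 0 ≤ (a : H →L[ℂ] H)) :
    ∃ s : A, star s * s = a := by
  refine ⟨rpowIn a (1 / 2), Subtype.ext ?_⟩
  change star ((a : H →L[ℂ] H) ^ (1 / 2 : ℝ)) * (a : H →L[ℂ] H) ^ (1 / 2 : ℝ) = a
  rw [← CFC.sqrt_eq_rpow, (CFC.sqrt_nonneg _).isSelfAdjoint.star_eq,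
    CFC.sqrt_mul_sqrt_self _ ha]

namespace IsUnitalSchwarz

variable {Φ : A →ₗ[ℂ] B}

theorem map_nonneg (h : IsUnitalSchwarz Φ) {a : A} (ha : 0 ≤ (a : H →L[ℂ] H)) :
    0 ≤ (Φ a : K →L[ℂ] K) := by
  obtain ⟨s, rfl⟩ := exists_star_mul_self_eq ha
  exact (star_mul_self_nonneg (Φ s : K →L[ℂ] K)).trans (h.schwarz s)

theorem map_mono (h : IsUnitalSchwarz Φ) {a b : A} (hab : (a : H →L[ℂ] H) ≤ b) :
    (Φ a : K →L[ℂ] K) ≤ Φ b := by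
  have hba : 0 ≤ (Φ (b - a) : K →L[ℂ] K) := h.map_nonneg (sub_nonneg.mpr hab)
  rwa [map_sub, AddSubgroupClass.coe_sub, sub_nonneg] at hba

theorem isSelfAdjoint_map (h : IsUnitalSchwarz Φ) {a : A} (ha : IsSelfAdjoint a) :
    IsSelfAdjoint (Φ a) := by
  -- `a` is the difference of the positive elements `‖a‖ • 1` and `‖a‖ • 1 - a`.
  have hle : (a : H →L[ℂ] H) ≤ ((‖a‖ : ℂ) • 1 : A) := by
    have h := IsSelfAdjoint.le_algebraMap_norm_self (congrArg Subtype.val ha : IsSelfAdjoint a.1)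
    rwa [Algebra.algebraMap_eq_smul_one] at h
  have hsub : IsSelfAdjoint (Φ ((‖a‖ : ℂ) • 1 - a)) :=
    Subtype.ext (h.map_nonneg (sub_nonneg.mpr hle)).isSelfAdjoint.star_eq
  rw [map_sub, map_smul, h.map_one] at hsub
  have hsmul : IsSelfAdjoint ((‖a‖ : ℂ) • 1 : B) := .smul (Complex.conj_ofReal _) (.one B)
  simpa only [sub_sub_cancel] using hsmul.sub hsub

theorem map_star (h : IsUnitalSchwarz Φ) (a : A) : Φ (star a) = star (Φ a) := by
  have hre := (h.isSelfAdjoint_map (realPart a).2).star_eq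
  have him := (h.isSelfAdjoint_map (imaginaryPart a).2).star_eq
  rw [← realPart_add_I_smul_imaginaryPart a]
  simp only [star_add, star_smul, (realPart a).2.star_eq, (imaginaryPart a).2.star_eq, map_add,
    map_smul, hre, him]

theorem comp {G : Type*} [NormedAddCommGroup G] [InnerProductSpace ℂ G] [CompleteSpace G]
    {C : StarSubalgebra ℂ (G →L[ℂ] G)} {Ψ : C →ₗ[ℂ] A} (hΦ : IsUnitalSchwarz Φ)
    (hΨ : IsUnitalSchwarz Ψ) : IsUnitalSchwarz (Φ ∘ₗ Ψ) where
  map_one := by simp only [LinearMap.comp_apply, hΨ.map_one, hΦ.map_one]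
  schwarz c := (hΦ.schwarz (Ψ c)).trans (hΦ.map_mono (hΨ.schwarz c))

end IsUnitalSchwarz

variable [FiniteDimensional ℂ K]

theorem hsAdjoint_comp {G : Type*} [NormedAddCommGroup G] [InnerProductSpace ℂ G]
    [FiniteDimensional ℂ G] [CompleteSpace G] {C : StarSubalgebra ℂ (G →L[ℂ] G)}
    (R : B →ₗ[ℂ] C) (T : A →ₗ[ℂ] B) : hsAdjoint (R ∘ₗ T) = hsAdjoint T ∘ₗ hsAdjoint R :=
  coreAdjoint_comp (hsCore A) (hsCore B) (hsCore C) R T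

theorem tr_hsAdjoint_mul {T : A →ₗ[ℂ] B} (hT : ∀ b, hsAdjoint T (star b) = star (hsAdjoint T b))
    (b : B) (a : A) : tr ((hsAdjoint T b).1 * a.1) = tr (b.1 * (T a).1) := by
  have h := hsAdjoint_spec T (star b) a
  rw [hT] at h
  simpa only [StarMemClass.coe_star, star_star] using h

theorem ext_tr_mul {a b : A} (h : ∀ x : A, tr (x.1 * a.1) = tr (x.1 * b.1)) : a = b := by
  refine sub_eq_zero.mp (Subtype.ext (eq_zero_of_tr_star_mul_self _ ?_))
  have h' := sub_eq_zero.mpr (h (star (a - b)))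
  simpa [tr, mul_sub] using h'

theorem map_star_of_hsAdjoint_map_star {T : A →ₗ[ℂ] B}
    (hT : ∀ b, hsAdjoint T (star b) = star (hsAdjoint T b)) (a : A) :
    T (star a) = star (T a) := by
  refine ext_tr_mul fun x ↦ ?_
  calc tr (x.1 * (T (star a)).1) = tr ((hsAdjoint T x).1 * star a.1) :=
        (tr_hsAdjoint_mul hT x (star a)).symm
    _ = star (tr (star (hsAdjoint T x).1 * a.1)) := by
        rw [← tr_star, star_mul, star_star, tr_mul_comm]
    _ = star (tr (star x.1 * (T a).1)) := by rw [hsAdjoint_spec]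
    _ = tr (x.1 * star (T a).1) := by
        rw [← tr_star, star_mul, star_star, tr_mul_comm]

variable {ρ : A}

/-- The GNS inner product `⟨a, b⟩ = Tr (a* b ρ)` of a faithful, i.e. positive and invertible,
weight `ρ`. -/
@[reducible] def gnsCore (hρ : 0 ≤ (ρ : H →L[ℂ] H)) (hu : IsUnit ρ) :
    InnerProductSpace.Core ℂ A where
  inner a b := tr (star a.1 * b.1 * ρ.1)
  conj_inner_symm a b := by
    rw [starRingEnd_apply, ← tr_star, star_mul, star_mul, star_star, hρ.isSelfAdjoint.star_eq,
      tr_mul_comm]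
  re_inner_nonneg a := re_tr_mul_nonneg (star_mul_self_nonneg _) hρ
  add_left a b c := by simp [add_mul, tr]
  smul_left a b r := by simp [tr]
  definite a h := by
    obtain ⟨s, rfl⟩ := exists_star_mul_self_eq hρ
    have has : a * star s = 0 := by
      refine Subtype.ext (eq_zero_of_tr_star_mul_self _ ?_)
      calc tr (star (a * star s).1 * (a * star s).1)
          = tr (s.1 * (star a.1 * a.1 * star s.1)) := by simp [mul_assoc]
        _ = tr (star a.1 * a.1 * star s.1 * s.1) := tr_mul_comm _ _
        _ = 0 := by simpa [mul_assoc] using h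
    exact hu.mul_left_eq_zero.mp (by rw [← mul_assoc, has, zero_mul])

variable {M : A →ₗ[ℂ] A}

theorem re_tr_star_hsAdjoint_mul_hsAdjoint_mul_le (hρ : 0 ≤ (ρ : H →L[ℂ] H))
    (hM : IsUnitalSchwarz (hsAdjoint M)) (hMρ : M ρ = ρ) (a : A) :
    (tr (star (hsAdjoint M a).1 * (hsAdjoint M a).1 * ρ.1)).re ≤
      (tr (star a.1 * a.1 * ρ.1)).re := by
  calc (tr (star (hsAdjoint M a).1 * (hsAdjoint M a).1 * ρ.1)).re
      ≤ (tr ((hsAdjoint M (star a * a)).1 * ρ.1)).re :=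
        re_tr_mul_le_re_tr_mul (hM.schwarz a) hρ
    _ = (tr (star a.1 * a.1 * ρ.1)).re := by
        rw [tr_hsAdjoint_mul hM.map_star, hMρ, MulMemClass.coe_mul, StarMemClass.coe_star]

theorem hsAdjoint_apply_eq_self_iff {u : Aˣ} (hu : 0 ≤ ((u : A) : H →L[ℂ] H))
    (hM : IsUnitalSchwarz (hsAdjoint M)) (hMu : M u = u) (a : A) :
    hsAdjoint M a = a ↔ M (a * u) = a * u := by
  rw [← Units.mul_inv_eq_iff_eq_mul]
  refine core_apply_eq_self_iff_of_inner_apply_le (gnsCore hu u.isUnit)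
    (W := fun b ↦ M (b * u) * ↑u⁻¹)
    (re_tr_star_hsAdjoint_mul_hsAdjoint_mul_le hu hM hMu) (fun x y ↦ ?_) a
  calc tr (star (hsAdjoint M x).1 * y.1 * (u : A).1)
      = tr (star x.1 * (M (y * u)).1) := by
        rw [← hsAdjoint_spec, mul_assoc, MulMemClass.coe_mul]
    _ = tr (star x.1 * (M (y * u) * ↑u⁻¹).1 * (u : A).1) := by
        rw [mul_assoc, ← MulMemClass.coe_mul, Units.inv_mul_cancel_right]

theorem map_unit_conj_eq_self {u : Aˣ} (hu : 0 ≤ ((u : A) : H →L[ℂ] H))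
    (hM : IsUnitalSchwarz (hsAdjoint M)) (hMu : M u = u) {τ : A} (hτ : M τ = τ) :
    M (u * τ * ↑u⁻¹) = u * τ * ↑u⁻¹ := by
  have hfix (a : A) := hsAdjoint_apply_eq_self_iff hu hM hMu a
  have hustar : star (u : A) = u := Subtype.ext hu.isSelfAdjoint.star_eq
  let a : A := τ * ↑u⁻¹
  have ha : hsAdjoint M a = a := (hfix a).mpr (by rwa [Units.inv_mul_cancel_right])
  have hstar : M (star a * u) = star a * u := (hfix _).mp (by rw [hM.map_star, ha])
  have h := congrArg star hstar
  rwa [← map_star_of_hsAdjoint_map_star hM.map_star, star_mul, star_star, hustar,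
    ← mul_assoc] at h

theorem ipowIn_zero {a : A} (ha : IsStarNormal (a : H →L[ℂ] H)) : ipowIn a 0 = 1 := by
  ext1
  simp only [ipowIn, Complex.ofReal_zero, mul_zero, Complex.cpow_zero]
  exact cfc_const_one ℂ (a : H →L[ℂ] H)

theorem subset_modularOrbit (hρ : IsStarNormal (ρ : H →L[ℂ] H)) (S : Set A) :
    S ⊆ modularOrbit ρ S := by
  refine fun σ hσ ↦ Set.mem_iUnion.mpr ⟨0, σ, hσ, ?_⟩
  simp only [neg_zero, ipowIn_zero hρ, one_mul, mul_one]

open scoped ComplexOrder in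
theorem ipowIn_mul_mul_ipowIn_neg_mem {u : Aˣ} (hu : 0 ≤ ((u : A) : H →L[ℂ] H))
    {N : Submodule ℂ A} (hN : ∀ x ∈ N, ↑u * x * ↑u⁻¹ ∈ N) (s : ℝ) {x : A} (hx : x ∈ N) :
    ipowIn (u : A) s * x * ipowIn (u : A) (-s) ∈ N := by
  let v : (H →L[ℂ] H)ˣ := Units.map A.subtype.toMonoidHom u
  let N' : Submodule ℂ (H →L[ℂ] H) := N.map A.subtype.toLinearMap
  have hN' : ∀ y ∈ N', ↑v * y * ↑v⁻¹ ∈ N' := by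
    rintro _ ⟨y, hy, rfl⟩
    exact ⟨_, hN y hy, rfl⟩
  have hcpow : ∀ μ ∈ spectrum ℂ (v : H →L[ℂ] H), ∀ ν ∈ spectrum ℂ (v : H →L[ℂ] H),
      μ ^ (Complex.I * s) * ν ^ (Complex.I * ((-s : ℝ) : ℂ)) =
        (μ * ν⁻¹) ^ (Complex.I * s) := by
    intro μ hμ ν hν
    rw [Complex.ofReal_neg, mul_neg, cpow_mul_cpow_neg (spectrum_nonneg_of_nonneg hu hμ)
      (spectrum_nonneg_of_nonneg hu hν)]
  have hmem := cfc_mul_mul_cfc_mem (u := v) (f := fun z ↦ z ^ (Complex.I * s))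
    (g := fun z ↦ z ^ (Complex.I * ((-s : ℝ) : ℂ))) (h := fun z ↦ z ^ (Complex.I * s))
    (IsSelfAdjoint.of_nonneg hu).isStarNormal (finite_spectrum _) hcpow hN'
    (x := (x : H →L[ℂ] H)) (Submodule.mem_map_of_mem hx)
  obtain ⟨y, hy, hyx⟩ := hmem
  have hy_eq : y = ipowIn (u : A) s * x * ipowIn (u : A) (-s) := Subtype.ext hyx
  rwa [hy_eq] at hy

theorem map_ipowIn_conj_eq_self {u : Aˣ} (hu : 0 ≤ ((u : A) : H →L[ℂ] H))
    (hM : IsUnitalSchwarz (hsAdjoint M)) (hMu : M u = u) {τ : A} (hτ : M τ = τ) (s : ℝ) :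
    M (ipowIn (u : A) s * τ * ipowIn (u : A) (-s)) = ipowIn (u : A) s * τ * ipowIn (u : A) (-s) :=
  ipowIn_mul_mul_ipowIn_neg_mem (N := LinearMap.eqLocus M LinearMap.id) hu
    (fun _ hx ↦ map_unit_conj_eq_self hu hM hMu hx) s hτ

end Operators

end QuantumReversibility

end

open QuantumReversibility in
theorem corollary1_general
    {H : Type*} [NormedAddCommGroup H] [InnerProductSpace ℂ H] [FiniteDimensional ℂ H]
    [CompleteSpace H]
    {K : Type*} [NormedAddCommGroup K] [InnerProductSpace ℂ K] [FiniteDimensional ℂ K]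
    [CompleteSpace K]
    (A : StarSubalgebra ℂ (H →L[ℂ] H)) (B : StarSubalgebra ℂ (K →L[ℂ] K))
    (S : Set A) (T : A →ₗ[ℂ] B) (ρ : A)
    (hρS : ρ ∈ S) (hρ0 : 0 ≤ (ρ : H →L[ℂ] H)) (hρ : IsUnit ρ)
    (hT : IsUnitalSchwarz (hsAdjoint T)) :
    IsReversible T S ↔ IsReversible T (modularOrbit ρ S) := by
  constructor
  · rintro ⟨R, hR, hfix⟩
    refine ⟨R, hR, fun σ hσ ↦ ?_⟩
    obtain ⟨s, τ, hτ, rfl⟩ := Set.mem_iUnion.mp hσ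
    have hM : IsUnitalSchwarz (hsAdjoint (R ∘ₗ T)) := hsAdjoint_comp R T ▸ hT.comp hR
    obtain ⟨u, rfl⟩ := hρ
    exact map_ipowIn_conj_eq_self hρ0 hM (hfix u hρS) (hfix τ hτ) s
  · rintro ⟨R, hR, hfix⟩
    have hnormal : IsStarNormal (ρ : H →L[ℂ] H) := (IsSelfAdjoint.of_nonneg hρ0).isStarNormal
    exact ⟨R, hR, fun σ hσ ↦ hfix σ (subset_modularOrbit hnormal S hσ)⟩

theorem corollary1
    {H : Type*} [NormedAddCommGroup H] [InnerProductSpace ℂ H] [FiniteDimensional ℂ H]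
    [CompleteSpace H]
    {K : Type*} [NormedAddCommGroup K] [InnerProductSpace ℂ K] [FiniteDimensional ℂ K]
    [CompleteSpace K]
    (A : StarSubalgebra ℂ (H →L[ℂ] H)) (B : StarSubalgebra ℂ (K →L[ℂ] K))
    (S : Set A) (hS : S ⊆ QuantumReversibility.densities A)
    (T : A →ₗ[ℂ] B) (ρ : A)
    (hρS : ρ ∈ S) (hρ : IsUnit ρ) (hTρ : IsUnit (T ρ))
    (hT : QuantumReversibility.IsUnitalSchwarz (QuantumReversibility.hsAdjoint T))
    (hTd : QuantumReversibility.IsUnitalSchwarz (QuantumReversibility.dualMap T ρ)) :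
    QuantumReversibility.IsReversible T S ↔
      QuantumReversibility.IsReversible T (QuantumReversibility.modularOrbit ρ S) :=
  corollary1_general A B S T ρ hρS (hS hρS).1 hρ hT
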